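/- For $\mathcal{E}\in(0,1)$ let $$u_0(x)=\sqrt{1-\mathcal{E}}\;\mathrm{sn}\!\left(x\sqrt{\tfrac{1+\mathcal{E}}{2}},\,k\right),\qquad k=\sqrt{\tfrac{1-\mathcal{E}}{1+\mathcal{E}}},$$ where $\mathrm{sn}(\cdot,k)$ is the Jacobi elliptic function of modulus $k$; this is a real periodic solution of $u_0''+(1-u_0^2)u_0=0$. Consider the (formal) functionals of $\psi$ $$E(\psi)=\int\Big[|\psi_x|^2+\tfrac12(1-|\psi|^2)^2\Big]dx,\qquad Q(\psi)=\int|\psi|^2\,dx,$$ $$R(\psi)=\int\Big[|\psi_{xx}|^2+3|\psi|^2|\psi_x|^2+\tfrac12(\bar\psi\psi_x+\psi\bar\psi_x)^2+\tfrac12|\psi|^6\Big]dx,$$ $$S(\psi)=R(\psi)-\tfrac12(3-\mathcal{E}^2)Q(\psi),\qquad \Lambda_c(\psi)=S(\psi)-cE(\psi)\quad(c\in\mathbb{R}).$$ Let $\mathcal{L}_c(\psi,\psi_x,\psi_{xx})$ be the integrand of $\Lambda_c$. The second variation of $\Lambda_c$ at $u_0$ in the direction $w\in H^2(\mathbb{R};\mathbb{C})$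 is $$\langle\Lambda_c''(u_0)w,w\rangle=\int_{\mathbb{R}}\frac{d^2}{d\varepsilon^2}\Big|_{\varepsilon=0}\mathcal{L}_c\big(u_0+\varepsilon w,\;u_0'+\varepsilon w_x,\;u_0''+\varepsilon w_{xx}\big)\,dx .$$ **Proposition.** There exists $\mathcal{E}_0\in(0,1)$ such that for every $\mathcal{E}\in(\mathcal{E}_0,1)$ there exist $c_-=c_-(\mathcal{E})$ and $c_+=c_+(\mathcal{E})$ with $1<c_-<2<c_+<3$ such that, for every $c\in(c_-,c_+)$ and every $w\in H^2(\mathbb{R};\mathbb{C})$, the integral defining $\langle\Lambda_c''(u_0)w,w\rangle$ converges absolutely and $$\langle\Lambda_c''(u_0)w,w\rangle\ge 0 .$$ Moreover, these values can be chosen so that $$c_\pm(\mathcal{E})=2\pm\sqrt{2(1-\mathcal{E})}+O(1-\mathcal{E})\qquad\text{as }\mathcal{E}\to1^- .$$ -/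

import Mathlib

noncomputable section

namespace CnoidalNLS

open MeasureTheory
open scoped ComplexConjugate ContDiff

/-- Incomplete elliptic integral of the first kind
`F(φ, k) = ∫₀^φ dθ / √(1 - k² sin² θ)`. -/
def ellipticF (k φ : ℝ) : ℝ :=
  ∫ θ in (0 : ℝ)..φ, 1 / Real.sqrt (1 - k ^ 2 * Real.sin θ ^ 2)

/-- Jacobi amplitude `am(ξ, k)`: the inverse function of `φ ↦ F(φ, k)`, which is an increasing
bijection of `ℝ` when `|k| < 1`. -/
def jacobiAm (ξ k : ℝ) : ℝ := Function.invFun (ellipticF k) ξ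

/-- Jacobi elliptic function `sn(ξ, k) = sin (am(ξ, k))`. -/
def jacobiSn (ξ k : ℝ) : ℝ := Real.sin (jacobiAm ξ k)

/-- The cnoidal wave profile
`u₀(x) = √(1 - 𝓔) sn(x √((1 + 𝓔)/2), √((1 - 𝓔)/(1 + 𝓔)))`. -/
def profile (𝓔 x : ℝ) : ℝ :=
  Real.sqrt (1 - 𝓔) *
    jacobiSn (x * Real.sqrt ((1 + 𝓔) / 2)) (Real.sqrt ((1 - 𝓔) / (1 + 𝓔)))

/-- Density of the energy `E`, as a function of the values `p = ψ`, `q = ψ_x`. -/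
def energyDensity (p q : ℂ) : ℝ := ‖q‖ ^ 2 + 1 / 2 * (1 - ‖p‖ ^ 2) ^ 2

/-- Density of the charge `Q`. -/
def chargeDensity (p : ℂ) : ℝ := ‖p‖ ^ 2

/-- Density of the higher-order functional `R`, as a function of `p = ψ`, `q = ψ_x`, `r = ψ_xx`.
The number `conj p * q + p * conj q` is real. -/
def higherDensity (p q r : ℂ) : ℝ :=
  ‖r‖ ^ 2 + 3 * ‖p‖ ^ 2 * ‖q‖ ^ 2 + 1 / 2 * (conj p * q + p * conj q).re ^ 2 + 1 / 2 * ‖p‖ ^ 6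

/-- Density of `S = R - (3 - 𝓔²)/2 Q`. -/
def actionDensity (𝓔 : ℝ) (p q r : ℂ) : ℝ :=
  higherDensity p q r - 1 / 2 * (3 - 𝓔 ^ 2) * chargeDensity p

/-- Density of `Λ_c = S - c E`. -/
def lambdaDensity (𝓔 c : ℝ) (p q r : ℂ) : ℝ :=
  actionDensity 𝓔 p q r - c * energyDensity p q

/-- `w'` is the weak derivative of `w` on `ℝ`. -/
def HasWeakDeriv (w w' : ℝ → ℂ) : Prop :=
  ∀ φ : ℝ → ℝ, ContDiff ℝ ∞ φ → HasCompactSupport φ →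
    ∫ x, deriv φ x • w x = -∫ x, φ x • w' x

/-- `w` belongs to the Sobolev space `H²(ℝ; ℂ)`, and its first and second weak derivatives
are `w₁` and `w₂`. -/
structure IsH2 (w w₁ w₂ : ℝ → ℂ) : Prop where
  memLp : MemLp w 2 volume
  memLp_fst : MemLp w₁ 2 volume
  memLp_snd : MemLp w₂ 2 volume
  weak_fst : HasWeakDeriv w w₁
  weak_snd : HasWeakDeriv w₁ w₂

/-- The second derivative at `ε = 0` of the density of `Λ_c` along `u₀ + ε w`, at the point `x`,
where `w₁`, `w₂` are the first and second derivatives of `w`. -/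
def secondVariationDensity (𝓔 c : ℝ) (w w₁ w₂ : ℝ → ℂ) (x : ℝ) : ℝ :=
  iteratedDeriv 2 (fun ε : ℝ => lambdaDensity 𝓔 c
    (((profile 𝓔 x : ℝ) : ℂ) + ε • w x)
    (((deriv (profile 𝓔) x : ℝ) : ℂ) + ε • w₁ x)
    (((deriv (deriv (profile 𝓔)) x : ℝ) : ℂ) + ε • w₂ x)) 0

/-- The second variation `⟨Λ_c''(u₀) w, w⟩` for perturbations on the whole line. The functional
itself diverges at the periodic profile `u₀` on the line, so the differentiation in `ε` is carried
out under the integral sign. -/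
def secondVariation (𝓔 c : ℝ) (w w₁ w₂ : ℝ → ℂ) : ℝ :=
  ∫ x, secondVariationDensity 𝓔 c w w₁ w₂ x

end CnoidalNLS

end

/-! Modulo null Lagrangians, that is, derivatives of functions in `W^{1,1}(ℝ)`, which integrate to
zero, the density of the second variation at `c = 2` is a sum of two squares `f² + g²` on each of
the real perturbations `u` and the imaginary perturbations `i v`. In the imaginary case
`f = L₋ v = -v'' - (1 - u₀²) v` and `g` is the Wronskian of `u₀` and `v`, so that both vanish at the
kernel element `v = u₀`; in the real case both vanish at `u = u₀'`. For `c = 2 + δ`, the additional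
energy density, which is `-δ (v'² - (1 - u₀²) v²)` in the imaginary case, is modulo a null
Lagrangian also a combination of `f g` and `g²`, and `(u₀ u₀' g²)'` is one more null Lagrangian with
a free multiplicity `l`. The result is a form `f² + 2 q f g + m g²` with coefficients depending on
`u₀` and `u₀'`, which is nonnegative as soon as `q² ≤ m`.

As `𝓔 → 1` the orbit `(u₀, u₀') / √(1 - 𝓔)` tends to the unit circle. With `d = δ / √(1 - 𝓔)` and
the choice `l = δ² / (2 (1 - 𝓔)²)`, the dependence of `m - q²` on the position cancels at leading
order and leaves `1 - d² / 2`, up to an error `O(√(1 - 𝓔))`. Hence the condition is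
`|δ| ≤ √(2 (1 - 𝓔)) - O(1 - 𝓔)`. -/

noncomputable section

namespace CnoidalNLS

open MeasureTheory Set Filter Topology
open scoped ContDiff ENNReal

section WeakDerivative

variable {E F : Type*} [NormedAddCommGroup E] [NormedSpace ℝ E] [NormedAddCommGroup F]
  [NormedSpace ℝ F]

theorem exists_hasCompactSupport_deriv_eq [CompleteSpace E] {χ : ℝ → E} (hχ : ContDiff ℝ ∞ χ)
    (hc : HasCompactSupport χ) (h0 : ∫ x, χ x = 0) :
    ∃ Φ : ℝ → E, ContDiff ℝ ∞ Φ ∧ HasCompactSupport Φ ∧ deriv Φ = χ := by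
  obtain ⟨M, hM⟩ : ∃ M, tsupport χ ⊆ Ioc (-M) M := by
    obtain ⟨R, hR⟩ := hc.isCompact.isBounded.subset_ball 0
    refine ⟨R, hR.trans ?_⟩
    rw [Real.ball_eq_Ioo, zero_sub, zero_add]
    exact Ioo_subset_Ioc_self
  have hzero : ∀ x ∉ Ioc (-M) M, χ x = 0 := fun x hx =>
    image_eq_zero_of_notMem_tsupport fun h => hx (hM h)
  let Φ : ℝ → E := fun x => ∫ t in (-M)..x, χ t
  have hderiv : ∀ x, HasDerivAt Φ (χ x) x := fun x =>
    (hχ.continuous.integral_hasStrictDerivAt _ x).hasDerivAt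
  have hderiv_eq : deriv Φ = χ := funext fun x => (hderiv x).deriv
  refine ⟨Φ, ?_, ?_, hderiv_eq⟩
  · rw [contDiff_infty_iff_deriv, hderiv_eq]
    exact ⟨fun x => (hderiv x).differentiableAt, hχ⟩
  · refine HasCompactSupport.intro isCompact_Icc (K := Icc (-M) M) fun x hx => ?_
    rcases not_and_or.1 hx with hx | hx <;> rw [not_le] at hx
    · refine intervalIntegral.integral_zero_ae (ae_of_all _ fun t ht => hzero t fun ht' => ?_)
      rw [uIoc_of_ge hx.le] at ht
      exact absurd ht'.1 (not_lt.2 ht.2)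
    · refine (intervalIntegral.integral_eq_integral_of_support_subset fun t ht => ?_).trans h0
      exact Ioc_subset_Ioc_right hx.le (hM (subset_tsupport _ ht))

/-- `f'` is the weak derivative of the vector-valued function `f` on `ℝ`; for `E = ℂ` this is
`HasWeakDeriv`. The general form is needed to pass to real and imaginary parts. -/
def IsWeakDeriv (f f' : ℝ → E) : Prop :=
  ∀ φ : ℝ → ℝ, ContDiff ℝ ∞ φ → HasCompactSupport φ →
    ∫ x, deriv φ x • f x = -∫ x, φ x • f' x

theorem integrable_deriv_smul {f : ℝ → E} (hf : LocallyIntegrable f) {φ : ℝ → ℝ}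
    (hφ : ContDiff ℝ ∞ φ) (hc : HasCompactSupport φ) : Integrable fun x => deriv φ x • f x :=
  hf.integrable_smul_left_of_hasCompactSupport (hφ.continuous_deriv (by simp)) hc.deriv

theorem integrable_smul {f : ℝ → E} (hf : LocallyIntegrable f) {φ : ℝ → ℝ}
    (hφ : ContDiff ℝ ∞ φ) (hc : HasCompactSupport φ) : Integrable fun x => φ x • f x :=
  hf.integrable_smul_left_of_hasCompactSupport hφ.continuous hc

theorem IsWeakDeriv.clm_comp [CompleteSpace E] [CompleteSpace F] {f f' : ℝ → E}
    (h : IsWeakDeriv f f') (hf : LocallyIntegrable f) (hf' : LocallyIntegrable f')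
    (L : E →L[ℝ] F) :
    IsWeakDeriv (fun x => L (f x)) (fun x => L (f' x)) := by
  intro φ hφ hc
  have := congrArg L (h φ hφ hc)
  rw [map_neg, ← L.integral_comp_comm (integrable_deriv_smul hf hφ hc),
    ← L.integral_comp_comm (integrable_smul hf' hφ hc)] at this
  simpa only [map_smul] using this

theorem IsWeakDeriv.ae_eq_const [CompleteSpace E] {f : ℝ → E} (hf : LocallyIntegrable f)
    (h : IsWeakDeriv f 0) : ∃ C : E, ∀ᵐ x, f x = C := by
  let b : ContDiffBump (0 : ℝ) := ⟨1, 2, by norm_num, by norm_num⟩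
  let ψ : ℝ → ℝ := b.normed volume
  have hψ : ContDiff ℝ ∞ ψ := b.contDiff_normed
  have hψc : HasCompactSupport ψ := b.hasCompactSupport_normed
  have hψ1 : ∫ x, ψ x = 1 := b.integral_normed
  refine ⟨∫ x, ψ x • f x,
    ae_eq_of_integral_contDiff_smul_eq hf (locallyIntegrable_const _) fun φ hφ hφc => ?_⟩
  have hiφ : Integrable φ := hφ.continuous.integrable_of_hasCompactSupport hφc
  have hiψ : Integrable ψ := hψ.continuous.integrable_of_hasCompactSupport hψc
  -- Subtracting the multiple of `ψ` with the same mass turns `φ` into a derivative.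
  obtain ⟨Φ, hΦ, hΦc, hΦ'⟩ := exists_hasCompactSupport_deriv_eq
    (χ := fun x => φ x - (∫ y, φ y) * ψ x) (hφ.sub (contDiff_const.mul hψ))
    (hφc.sub hψc.mul_left)
    (by rw [integral_sub hiφ (hiψ.const_mul _), integral_const_mul, hψ1, mul_one, sub_self])
  have htest := h Φ hΦ hΦc
  simp only [hΦ', sub_smul, mul_smul, Pi.zero_apply, smul_zero, integral_zero, neg_zero] at htest
  have hiψf : Integrable fun x => (∫ y, φ y) • ψ x • f x := (integrable_smul hf hψ hψc).smul _
  rw [integral_sub (integrable_smul hf hφ hφc) hiψf, integral_smul, sub_eq_zero] at htest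
  rw [htest, integral_smul_const]

end WeakDerivative

section AbsolutelyContinuous

theorem integral_eq_zero_of_absolutelyContinuous {f f' : ℝ → ℝ}
    (hac : ∀ a b, AbsolutelyContinuousOnInterval f a b) (hderiv : ∀ᵐ x, HasDerivAt f (f' x) x)
    (hf : Integrable f) (hf' : Integrable f') : ∫ x, f' x = 0 := by
  have hlim : Tendsto (fun R : ℝ => f R - f (-R)) atTop (𝓝 (∫ x, f' x)) := by
    refine (intervalIntegral_tendsto_integral hf' tendsto_neg_atTop_atBot tendsto_id).congr
      fun R => ?_
    rw [id, ← (hac (-R) R).integral_deriv_eq_sub]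
    refine intervalIntegral.integral_congr_ae ?_
    filter_upwards [hderiv] with x hx _ using hx.deriv.symm
  -- An integrable function can only converge to `0` at infinity.
  refine IntegrableAtFilter.eq_zero_of_tendsto (μ := volume)
    ⟨univ, univ_mem, (hf.sub hf.comp_neg).integrableOn⟩ (fun s hs => ?_) hlim
  obtain ⟨b, hb⟩ := mem_atTop_sets.1 hs
  rw [← top_le_iff, ← Real.volume_Ici (a := b)]
  exact measure_mono hb

theorem absolutelyContinuousOnInterval_integral {f : ℝ → ℝ} (hf : LocallyIntegrable f)
    (c a b : ℝ) : AbsolutelyContinuousOnInterval (fun x => ∫ t in c..x, f t) a b := by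
  have hint : IntervalIntegrable f volume (min c (min a b)) (max c (max a b)) :=
    (hf.integrableOn_isCompact isCompact_uIcc).intervalIntegrable
  have hle : min c (min a b) ≤ max c (max a b) := (min_le_left _ _).trans (le_max_left _ _)
  refine (hint.absolutelyContinuousOnInterval_intervalIntegral (c := c) ?_).mono ?_ <;>
    rw [uIcc_of_le hle]
  · exact ⟨min_le_left _ _, le_max_left _ _⟩
  · exact Icc_subset_Icc (min_le_right _ _) (le_max_right _ _)

theorem IsWeakDeriv.exists_absolutelyContinuous {f f' : ℝ → ℝ} (h : IsWeakDeriv f f')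
    (hf : LocallyIntegrable f) (hf' : LocallyIntegrable f') :
    ∃ F : ℝ → ℝ, (∀ a b, AbsolutelyContinuousOnInterval F a b) ∧ F =ᵐ[volume] f ∧
      ∀ᵐ x, HasDerivAt F (f' x) x := by
  let I : ℝ → ℝ := fun x => ∫ t in (0 : ℝ)..x, f' t
  have hac : ∀ a b, AbsolutelyContinuousOnInterval I a b :=
    absolutelyContinuousOnInterval_integral hf' 0
  have hderiv : ∀ᵐ x, HasDerivAt I (f' x) x := by
    filter_upwards [_root_.LocallyIntegrable.ae_hasDerivAt_integral hf'] with x hx using hx 0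
  have hI : LocallyIntegrable I :=
    (intervalIntegral.continuous_primitive (fun a b =>
      (hf'.integrableOn_isCompact isCompact_uIcc).intervalIntegrable) 0).locallyIntegrable
  obtain ⟨C, hC⟩ := IsWeakDeriv.ae_eq_const (hf.sub hI) (f := f - I) fun φ hφ hφc => by
    have hparts : ∫ x, (deriv φ x • I x + φ x • f' x) = 0 := by
      refine integral_eq_zero_of_absolutelyContinuous (f := fun x => φ x • I x)
        (fun a b => (hφ.of_le (by simp)).contDiffOn.absolutelyContinuousOnInterval.fun_mul
          (hac a b)) ?_ (integrable_smul hI hφ hφc)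
        ((integrable_deriv_smul hI hφ hφc).add (integrable_smul hf' hφ hφc))
      filter_upwards [hderiv] with x hx
      exact ((hφ.differentiable (by simp)).differentiableAt.hasDerivAt).fun_mul hx
    rw [integral_add (integrable_deriv_smul hI hφ hφc) (integrable_smul hf' hφ hφc)] at hparts
    simp only [Pi.sub_apply, smul_sub, Pi.zero_apply, smul_zero, integral_zero, neg_zero]
    rw [integral_sub (integrable_deriv_smul hf hφ hφc) (integrable_deriv_smul hI hφ hφc),
      h φ hφ hφc]
    linarith
  refine ⟨fun x => C + I x,
    fun a b => contDiff_const.contDiffOn.absolutelyContinuousOnInterval.fun_add (hac a b), ?_, ?_⟩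
  · filter_upwards [hC] with x hx
    rw [← hx, Pi.sub_apply, sub_add_cancel]
  · filter_upwards [hderiv] with x hx using hx.const_add C

end AbsolutelyContinuous

section Sobolev

/-- `f` belongs to the Sobolev space `W^{1,p}(ℝ)` and has derivative `f'`. In one dimension the
weak derivative can be expressed through a locally absolutely continuous representative, which is
the form in which products and integrations by parts are immediate. -/
structure MemW1 (p : ℝ≥0∞) (f f' : ℝ → ℝ) : Prop where
  memLp : MemLp f p volume
  memLp_deriv : MemLp f' p volume
  exists_rep : ∃ F : ℝ → ℝ, (∀ a b, AbsolutelyContinuousOnInterval F a b) ∧ F =ᵐ[volume] f ∧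
    ∀ᵐ x, HasDerivAt F (f' x) x

namespace MemW1

variable {p q s : ℝ≥0∞} {f f' g g' : ℝ → ℝ}

theorem of_hasDerivAt (hderiv : ∀ x, HasDerivAt f (f' x) x) (hcont : Continuous f')
    (hf : MemLp f p volume) (hf' : MemLp f' p volume) : MemW1 p f f' := by
  have hC1 : ContDiff ℝ 1 f := contDiff_one_iff_deriv.2
    ⟨fun x => (hderiv x).differentiableAt,
      (funext fun x => (hderiv x).deriv : deriv f = f') ▸ hcont⟩
  exact ⟨hf, hf', f, fun _ _ => hC1.contDiffOn.absolutelyContinuousOnInterval, .rfl,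
    ae_of_all _ hderiv⟩

theorem congr (h : MemW1 p f f') (hf : ∀ x, f x = g x) (hf' : ∀ x, f' x = g' x) :
    MemW1 p g g' :=
  funext hf ▸ funext hf' ▸ h

theorem const (c : ℝ) : MemW1 ∞ (fun _ => c) (fun _ => 0) :=
  of_hasDerivAt (fun x => hasDerivAt_const x c) continuous_const (memLp_top_const c)
    (memLp_top_const 0)

theorem add (hf : MemW1 p f f') (hg : MemW1 p g g') :
    MemW1 p (fun x => f x + g x) (fun x => f' x + g' x) := by
  obtain ⟨F, hF, hFf, hF'⟩ := hf.exists_rep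
  obtain ⟨G, hG, hGg, hG'⟩ := hg.exists_rep
  refine ⟨hf.memLp.add hg.memLp, hf.memLp_deriv.add hg.memLp_deriv,
    fun x => F x + G x, fun a b => (hF a b).fun_add (hG a b), hFf.add hGg, ?_⟩
  filter_upwards [hF', hG'] with x hx hy using hx.fun_add hy

theorem const_mul (hf : MemW1 p f f') (c : ℝ) :
    MemW1 p (fun x => c * f x) (fun x => c * f' x) := by
  obtain ⟨F, hF, hFf, hF'⟩ := hf.exists_rep
  refine ⟨hf.memLp.const_mul c, hf.memLp_deriv.const_mul c, fun x => c * F x,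
    fun a b => (hF a b).const_mul c, hFf.const_smul c, ?_⟩
  filter_upwards [hF'] with x hx using hx.const_mul c

theorem sub (hf : MemW1 p f f') (hg : MemW1 p g g') :
    MemW1 p (fun x => f x - g x) (fun x => f' x - g' x) :=
  (hf.add (hg.const_mul (-1))).congr (fun _ => by ring) (fun _ => by ring)

theorem mul [ENNReal.HolderTriple p q s] (hf : MemW1 p f f') (hg : MemW1 q g g') :
    MemW1 s (fun x => f x * g x) (fun x => f' x * g x + f x * g' x) := by
  obtain ⟨F, hF, hFf, hF'⟩ := hf.exists_rep
  obtain ⟨G, hG, hGg, hG'⟩ := hg.exists_rep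
  refine ⟨hg.memLp.mul' hf.memLp,
    (hg.memLp.mul' hf.memLp_deriv).add (hg.memLp_deriv.mul' hf.memLp),
    fun x => F x * G x, fun a b => (hF a b).fun_mul (hG a b), hFf.mul hGg, ?_⟩
  filter_upwards [hF', hG', hFf, hGg] with x hx hy hxf hyg
  exact hxf ▸ hyg ▸ hx.fun_mul hy

theorem top_mul (hf : MemW1 ∞ f f') (hg : MemW1 p g g') :
    MemW1 p (fun x => f x * g x) (fun x => f' x * g x + f x * g' x) :=
  hf.mul hg

theorem mul_of_two (hf : MemW1 2 f f') (hg : MemW1 2 g g') :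
    MemW1 1 (fun x => f x * g x) (fun x => f' x * g x + f x * g' x) :=
  hf.mul hg

theorem inv_of_hasDerivAt {m : ℝ} (hderiv : ∀ x, HasDerivAt f (f' x) x) (hcont : Continuous f')
    (hf' : MemLp f' ∞ volume) (hm : 0 < m) (hmf : ∀ x, m ≤ f x) :
    MemW1 ∞ (fun x => (f x)⁻¹) (fun x => -f' x / f x ^ 2) := by
  have hpos : ∀ x, 0 < f x := fun x => hm.trans_le (hmf x)
  have hf : Continuous f := continuous_iff_continuousAt.2 fun x => (hderiv x).continuousAt
  have hinv : MemLp (fun x => (f x)⁻¹) ∞ volume := by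
    refine memLp_top_of_bound (hf.inv₀ fun x => (hpos x).ne').aestronglyMeasurable m⁻¹
      (ae_of_all _ fun x => ?_)
    rw [Real.norm_of_nonneg (inv_nonneg.2 (hpos x).le)]
    exact inv_anti₀ hm (hmf x)
  refine of_hasDerivAt (fun x => (hderiv x).fun_inv (hpos x).ne')
    (hcont.neg.div (hf.pow 2) fun x => (pow_pos (hpos x) 2).ne') hinv ?_
  convert (hinv.mul' hinv (r := ∞)).mul' hf'.neg (r := ∞) using 2 with x
  rw [Pi.neg_apply, div_eq_mul_inv, pow_two, mul_inv]

theorem integral_eq_zero (h : MemW1 1 f f') : ∫ x, f' x = 0 := by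
  obtain ⟨F, hF, hFf, hF'⟩ := h.exists_rep
  exact integral_eq_zero_of_absolutelyContinuous hF hF'
    ((memLp_one_iff_integrable.1 h.memLp).congr hFf.symm) (memLp_one_iff_integrable.1 h.memLp_deriv)

theorem integral_nonneg (h : MemW1 1 f f') (hg : Integrable g) (hle : ∀ x, f' x ≤ g x) :
    0 ≤ ∫ x, g x :=
  h.integral_eq_zero ▸ integral_mono (memLp_one_iff_integrable.1 h.memLp_deriv) hg hle

end MemW1

theorem IsWeakDeriv.memW1 {p : ℝ≥0∞} (hp : 1 ≤ p) {f f' : ℝ → ℝ} (h : IsWeakDeriv f f')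
    (hf : MemLp f p volume) (hf' : MemLp f' p volume) : MemW1 p f f' :=
  ⟨hf, hf', h.exists_absolutelyContinuous (hf.locallyIntegrable hp) (hf'.locallyIntegrable hp)⟩

end Sobolev

section JacobiFunctions

/-- The Jacobi elliptic function `cn(ξ, k) = cos (am(ξ, k))`. -/
def jacobiCn (ξ k : ℝ) : ℝ := Real.cos (jacobiAm ξ k)

/-- The Jacobi elliptic function `dn(ξ, k)`, that is, the derivative of `am(ξ, k)` in `ξ`. -/
def jacobiDn (ξ k : ℝ) : ℝ := √(1 - k ^ 2 * jacobiSn ξ k ^ 2)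

variable {k : ℝ}

theorem one_sub_mul_sin_sq_pos (hk : k ^ 2 < 1) (θ : ℝ) : 0 < 1 - k ^ 2 * Real.sin θ ^ 2 :=
  sub_pos.2 ((mul_le_of_le_one_right (sq_nonneg k) (Real.sin_sq_le_one θ)).trans_lt hk)

theorem hasDerivAt_ellipticF (hk : k ^ 2 < 1) (φ : ℝ) :
    HasDerivAt (ellipticF k) (1 / √(1 - k ^ 2 * Real.sin φ ^ 2)) φ := by
  have hcont : Continuous fun θ => 1 / √(1 - k ^ 2 * Real.sin θ ^ 2) :=
    continuous_const.div (by fun_prop) fun θ =>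
      (Real.sqrt_pos.2 (one_sub_mul_sin_sq_pos hk θ)).ne'
  exact (hcont.integral_hasStrictDerivAt 0 φ).hasDerivAt

theorem ellipticF_strictMono (hk : k ^ 2 < 1) : StrictMono (ellipticF k) :=
  strictMono_of_deriv_pos fun φ => by
    rw [(hasDerivAt_ellipticF hk φ).deriv]
    exact one_div_pos.2 (Real.sqrt_pos.2 (one_sub_mul_sin_sq_pos hk φ))

theorem monotone_ellipticF_sub_self (hk : k ^ 2 < 1) : Monotone fun φ => ellipticF k φ - φ := by
  have hderiv : ∀ φ, HasDerivAt (fun φ => ellipticF k φ - φ)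
      (1 / √(1 - k ^ 2 * Real.sin φ ^ 2) - 1) φ := fun φ =>
    (hasDerivAt_ellipticF hk φ).sub (hasDerivAt_id φ)
  refine monotone_of_deriv_nonneg (fun φ => (hderiv φ).differentiableAt) fun φ => ?_
  rw [(hderiv φ).deriv, sub_nonneg]
  exact one_le_one_div (Real.sqrt_pos.2 (one_sub_mul_sin_sq_pos hk φ))
    (Real.sqrt_le_one.2 (sub_le_self _ (by positivity)))

theorem ellipticF_surjective (hk : k ^ 2 < 1) : Function.Surjective (ellipticF k) := by
  have hmono := monotone_ellipticF_sub_self hk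
  have hzero : ellipticF k 0 - 0 = 0 := by simp [ellipticF]
  have hcont : Continuous (ellipticF k) :=
    continuous_iff_continuousAt.2 fun φ => (hasDerivAt_ellipticF hk φ).continuousAt
  refine hcont.surjective (tendsto_atTop_mono' _ ?_ tendsto_id)
    (tendsto_atBot_mono' _ ?_ tendsto_id)
  · filter_upwards [eventually_ge_atTop 0] with φ hφ
    exact sub_nonneg.1 (hzero ▸ hmono hφ)
  · filter_upwards [eventually_le_atBot 0] with φ hφ
    exact sub_nonpos.1 (hzero ▸ hmono hφ)

theorem ellipticF_jacobiAm (hk : k ^ 2 < 1) (ξ : ℝ) : ellipticF k (jacobiAm ξ k) = ξ :=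
  Function.rightInverse_invFun (ellipticF_surjective hk) ξ

theorem jacobiAm_ellipticF (hk : k ^ 2 < 1) (φ : ℝ) : jacobiAm (ellipticF k φ) k = φ :=
  Function.leftInverse_invFun (ellipticF_strictMono hk).injective φ

theorem continuous_jacobiAm (hk : k ^ 2 < 1) : Continuous fun ξ => jacobiAm ξ k := by
  refine Monotone.continuous_of_surjective (fun ξ ζ h => ?_) fun φ => ⟨_, jacobiAm_ellipticF hk φ⟩
  rwa [← (ellipticF_strictMono hk).le_iff_le, ellipticF_jacobiAm hk, ellipticF_jacobiAm hk]

theorem hasDerivAt_jacobiAm (hk : k ^ 2 < 1) (ξ : ℝ) :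
    HasDerivAt (fun ξ => jacobiAm ξ k) (jacobiDn ξ k) ξ := by
  have hpos := Real.sqrt_pos.2 (one_sub_mul_sin_sq_pos hk (jacobiAm ξ k))
  have := HasDerivAt.of_local_left_inverse (continuous_jacobiAm hk).continuousAt
    (hasDerivAt_ellipticF hk (jacobiAm ξ k)) (one_div_pos.2 hpos).ne'
    (Eventually.of_forall fun y => ellipticF_jacobiAm hk y)
  rwa [one_div, inv_inv] at this

theorem jacobiSn_sq_le_one (ξ k : ℝ) : jacobiSn ξ k ^ 2 ≤ 1 := Real.sin_sq_le_one _

theorem jacobiCn_sq (ξ k : ℝ) : jacobiCn ξ k ^ 2 = 1 - jacobiSn ξ k ^ 2 := Real.cos_sq' _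

theorem jacobiDn_sq (hk : k ^ 2 < 1) (ξ : ℝ) : jacobiDn ξ k ^ 2 = 1 - k ^ 2 * jacobiSn ξ k ^ 2 :=
  Real.sq_sqrt (one_sub_mul_sin_sq_pos hk _).le

theorem hasDerivAt_jacobiSn (hk : k ^ 2 < 1) (ξ : ℝ) :
    HasDerivAt (fun ξ => jacobiSn ξ k) (jacobiCn ξ k * jacobiDn ξ k) ξ :=
  (hasDerivAt_jacobiAm hk ξ).sin

theorem hasDerivAt_jacobiCn (hk : k ^ 2 < 1) (ξ : ℝ) :
    HasDerivAt (fun ξ => jacobiCn ξ k) (-jacobiSn ξ k * jacobiDn ξ k) ξ :=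
  (hasDerivAt_jacobiAm hk ξ).cos

theorem hasDerivAt_jacobiDn (hk : k ^ 2 < 1) (ξ : ℝ) :
    HasDerivAt (fun ξ => jacobiDn ξ k) (-k ^ 2 * jacobiSn ξ k * jacobiCn ξ k) ξ := by
  have hpos : 0 < 1 - k ^ 2 * jacobiSn ξ k ^ 2 := one_sub_mul_sin_sq_pos hk _
  have hdn : jacobiDn ξ k ≠ 0 := (Real.sqrt_pos.2 hpos).ne'
  have := ((((hasDerivAt_jacobiSn hk ξ).fun_pow 2).const_mul (k ^ 2)).const_sub 1).sqrt hpos.ne'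
  refine this.congr_deriv ?_
  change _ / (2 * jacobiDn ξ k) = _
  field_simp
  ring

end JacobiFunctions

section Cnoidal

/-- `U` is a solution, with derivative `W`, of `U'' + (1 - U²) U = 0` at the level `𝓔` of the first
integral that stays in the potential well `U² ≤ 1 - 𝓔`. -/
structure IsCnoidal (𝓔 : ℝ) (U W : ℝ → ℝ) : Prop where
  hasDerivAt : ∀ x, HasDerivAt U (W x) x
  hasDerivAt_deriv : ∀ x, HasDerivAt W (-(1 - U x ^ 2) * U x) x
  energy : ∀ x, W x ^ 2 = ((1 - U x ^ 2) ^ 2 - 𝓔 ^ 2) / 2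
  sq_le : ∀ x, U x ^ 2 ≤ 1 - 𝓔

theorem isCnoidal_of_jacobi {k ν τ : ℝ} (hk : k ^ 2 < 1) (hν : ν ^ 2 * (1 + k ^ 2) = 1)
    (hτ : τ ^ 2 = 2 * ν ^ 2 * k ^ 2) :
    IsCnoidal (1 - τ ^ 2) (fun x => τ * jacobiSn (x * ν) k)
      (fun x => τ * (ν * (jacobiCn (x * ν) k * jacobiDn (x * ν) k))) where
  hasDerivAt x := by
    have hscale : HasDerivAt (fun x : ℝ => x * ν) ν x := hasDerivAt_mul_const ν
    refine (((hasDerivAt_jacobiSn hk (x * ν)).comp x hscale).const_mul τ).congr_deriv ?_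
    ring
  hasDerivAt_deriv x := by
    have hscale : HasDerivAt (fun x : ℝ => x * ν) ν x := hasDerivAt_mul_const ν
    have hprod := (hasDerivAt_jacobiCn hk (x * ν)).fun_mul (hasDerivAt_jacobiDn hk (x * ν))
    refine (((hprod.comp x hscale).const_mul ν).const_mul τ).congr_deriv ?_
    set s := jacobiSn (x * ν) k
    linear_combination (-τ * ν ^ 2 * s) * jacobiDn_sq hk (x * ν)
      - τ * k ^ 2 * ν ^ 2 * s * jacobiCn_sq (x * ν) k - τ * s * hν - τ * s ^ 3 * hτ
  energy x := by
    set s := jacobiSn (x * ν) k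
    linear_combination τ ^ 2 * ν ^ 2 * jacobiDn (x * ν) k ^ 2 * jacobiCn_sq (x * ν) k
      + τ ^ 2 * ν ^ 2 * (1 - s ^ 2) * jacobiDn_sq hk (x * ν) + τ ^ 2 * (1 - s ^ 2) * hν
      + τ ^ 2 * (1 - s ^ 2) * (1 + s ^ 2) / 2 * hτ
  sq_le x := by
    rw [mul_pow, sub_sub_cancel]
    exact mul_le_of_le_one_right (sq_nonneg τ) (jacobiSn_sq_le_one _ _)

variable {𝓔 : ℝ} {U W : ℝ → ℝ}

theorem IsCnoidal.deriv_eq (h : IsCnoidal 𝓔 U W) : deriv U = W :=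
  funext fun x => (h.hasDerivAt x).deriv

theorem isCnoidal_profile (h0 : 0 < 𝓔) (h1 : 𝓔 ≤ 1) :
    IsCnoidal 𝓔 (profile 𝓔) (deriv (profile 𝓔)) := by
  have hτ : √(1 - 𝓔) ^ 2 = 1 - 𝓔 := Real.sq_sqrt (sub_nonneg.2 h1)
  have hν : √((1 + 𝓔) / 2) ^ 2 = (1 + 𝓔) / 2 := Real.sq_sqrt (by linarith)
  have hk : √((1 - 𝓔) / (1 + 𝓔)) ^ 2 = (1 - 𝓔) / (1 + 𝓔) :=
    Real.sq_sqrt (div_nonneg (by linarith) (by linarith))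
  have hjacobi := isCnoidal_of_jacobi
    (k := √((1 - 𝓔) / (1 + 𝓔))) (ν := √((1 + 𝓔) / 2)) (τ := √(1 - 𝓔))
    (by rw [hk, div_lt_one (by linarith)]; linarith)
    (by rw [hk, hν]; field_simp; ring)
    (by rw [hk, hν, hτ]; field_simp)
  rw [hτ, sub_sub_cancel] at hjacobi
  exact hjacobi.deriv_eq ▸ hjacobi

theorem IsCnoidal.sq_add_sq_le (h : IsCnoidal 𝓔 U W) (x : ℝ) : U x ^ 2 + W x ^ 2 ≤ 1 - 𝓔 := by
  nlinarith [h.energy x, h.sq_le x, sq_nonneg (U x)]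

theorem IsCnoidal.continuous_deriv (h : IsCnoidal 𝓔 U W) : Continuous W :=
  continuous_iff_continuousAt.2 fun x => (h.hasDerivAt_deriv x).continuousAt

theorem IsCnoidal.continuous (h : IsCnoidal 𝓔 U W) : Continuous U :=
  continuous_iff_continuousAt.2 fun x => (h.hasDerivAt x).continuousAt

theorem IsCnoidal.memLp_top (h : IsCnoidal 𝓔 U W) : MemLp U ∞ volume :=
  memLp_top_of_bound h.continuous.aestronglyMeasurable (√(1 - 𝓔)) <| ae_of_all _ fun x =>
    Real.le_sqrt_of_sq_le <| by
      rw [Real.norm_eq_abs, sq_abs]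
      exact h.sq_le x

theorem IsCnoidal.memLp_top_deriv (h : IsCnoidal 𝓔 U W) : MemLp W ∞ volume :=
  memLp_top_of_bound h.continuous_deriv.aestronglyMeasurable (√(1 - 𝓔)) <| ae_of_all _ fun x =>
    Real.le_sqrt_of_sq_le <| by
      rw [Real.norm_eq_abs, sq_abs]
      linarith [h.sq_add_sq_le x, sq_nonneg (U x)]

theorem IsCnoidal.memW1 (h : IsCnoidal 𝓔 U W) : MemW1 ∞ U W :=
  .of_hasDerivAt h.hasDerivAt h.continuous_deriv h.memLp_top h.memLp_top_deriv

theorem IsCnoidal.memLp_top_one_sub_sq (h : IsCnoidal 𝓔 U W) :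
    MemLp (fun x => 1 - U x ^ 2) ∞ volume := by
  refine (memLp_top_const 1).sub ?_
  simpa only [pow_two] using h.memLp_top.mul' h.memLp_top

theorem IsCnoidal.memW1_deriv (h : IsCnoidal 𝓔 U W) :
    MemW1 ∞ W (fun x => -(1 - U x ^ 2) * U x) := by
  refine .of_hasDerivAt h.hasDerivAt_deriv ?_ h.memLp_top_deriv
    (h.memLp_top.mul' h.memLp_top_one_sub_sq.neg)
  have := h.continuous
  fun_prop

theorem IsCnoidal.memW1_one_sub_sq (h : IsCnoidal 𝓔 U W) :
    MemW1 ∞ (fun x => 1 - U x ^ 2) (fun x => -(2 * U x * W x)) :=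
  ((MemW1.const 1).sub (h.memW1.top_mul h.memW1)).congr (fun x => by ring) (fun x => by ring)

theorem IsCnoidal.le_one_sub_sq (h : IsCnoidal 𝓔 U W) (x : ℝ) : 𝓔 ≤ 1 - U x ^ 2 :=
  le_sub_comm.1 (h.sq_le x)

theorem IsCnoidal.memW1_inv_one_sub_sq (h : IsCnoidal 𝓔 U W) (h0 : 0 < 𝓔) :
    MemW1 ∞ (fun x => (1 - U x ^ 2)⁻¹) (fun x => 2 * U x * W x / (1 - U x ^ 2) ^ 2) := by
  have hU := h.continuous
  have hW := h.continuous_deriv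
  have hderiv x : HasDerivAt (fun x => 1 - U x ^ 2) (-(2 * U x * W x)) x :=
    (((h.hasDerivAt x).fun_pow 2).const_sub 1).congr_deriv (by ring)
  exact (MemW1.inv_of_hasDerivAt hderiv (by fun_prop) h.memW1_one_sub_sq.memLp_deriv h0
    h.le_one_sub_sq).congr (fun _ => rfl) (fun x => by rw [neg_neg])

/-- The Wronskian `U'² - U U''` of a solution and its derivative, as a function of the values `U`
and `W = U'`. It has no zeros on a nonconstant bounded orbit. -/
def orbitWronskian (U W : ℝ) : ℝ := W ^ 2 + U ^ 2 * (1 - U ^ 2)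

theorem IsCnoidal.le_orbitWronskian (h : IsCnoidal 𝓔 U W) (x : ℝ) :
    𝓔 * (1 - 𝓔) ≤ orbitWronskian (U x) (W x) := by
  rw [orbitWronskian, h.energy x]
  nlinarith [mul_nonneg (sub_nonneg.2 (h.sq_le x)) (sub_nonneg.2 (h.sq_le x)),
    mul_nonneg (sub_nonneg.2 (h.sq_le x)) (sq_nonneg (U x))]

theorem IsCnoidal.orbitWronskian_ne_zero (h : IsCnoidal 𝓔 U W) (h0 : 0 < 𝓔) (h1 : 𝓔 < 1) (x : ℝ) :
    orbitWronskian (U x) (W x) ≠ 0 :=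
  ((mul_pos h0 (sub_pos.2 h1)).trans_le (h.le_orbitWronskian x)).ne'

theorem IsCnoidal.hasDerivAt_orbitWronskian (h : IsCnoidal 𝓔 U W) (x : ℝ) :
    HasDerivAt (fun x => orbitWronskian (U x) (W x)) (-(2 * U x ^ 3 * W x)) x := by
  have hU2 := (h.hasDerivAt x).fun_pow 2
  have hW2 := (h.hasDerivAt_deriv x).fun_pow 2
  exact (hW2.fun_add (hU2.fun_mul (hU2.const_sub 1))).congr_deriv (by ring)

theorem IsCnoidal.memW1_inv_orbitWronskian (h : IsCnoidal 𝓔 U W) (h0 : 0 < 𝓔) (h1 : 𝓔 < 1) :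
    MemW1 ∞ (fun x => (orbitWronskian (U x) (W x))⁻¹)
      (fun x => 2 * U x ^ 3 * W x / orbitWronskian (U x) (W x) ^ 2) := by
  have hU := h.continuous
  have hW := h.continuous_deriv
  have hmem : MemW1 ∞ (fun x => orbitWronskian (U x) (W x)) (fun x => -(2 * U x ^ 3 * W x)) :=
    ((h.memW1_deriv.top_mul h.memW1_deriv).add
      ((h.memW1.top_mul h.memW1).top_mul h.memW1_one_sub_sq)).congr
      (fun x => by rw [orbitWronskian]; ring) (fun x => by ring)
  exact (MemW1.inv_of_hasDerivAt h.hasDerivAt_orbitWronskian (by fun_prop)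
    hmem.memLp_deriv (mul_pos h0 (sub_pos.2 h1)) h.le_orbitWronskian).congr (fun _ => rfl)
    (fun x => by rw [neg_neg])

end Cnoidal

section Perturbations

theorem sq_add_two_mul_add_nonneg {q m : ℝ} (h : q ^ 2 ≤ m) (f g : ℝ) :
    0 ≤ f ^ 2 + 2 * q * (f * g) + m * g ^ 2 := by
  nlinarith [sq_nonneg (f + q * g), mul_nonneg (sub_nonneg.2 h) (sq_nonneg g)]

theorem IsCnoidal.integrable_energy {𝓔 : ℝ} {U W v v₁ : ℝ → ℝ} (h : IsCnoidal 𝓔 U W)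
    (hv : MemLp v 2 volume) (hv₁ : MemLp v₁ 2 volume) (a : ℝ) :
    Integrable fun x => v₁ x ^ 2 - (1 - a * U x ^ 2) * v x ^ 2 := by
  have hUv : MemLp (fun x => U x * v x) 2 volume := hv.mul' h.memLp_top
  refine ((hv₁.integrable_sq.sub hv.integrable_sq).add (hUv.integrable_sq.const_mul a)).congr
    (ae_of_all _ fun x => ?_)
  simp only [Pi.add_apply, Pi.sub_apply]
  ring

end Perturbations

section ImaginaryPerturbations

/-- Half the quadratic density of the second variation on purely imaginary perturbations `i v`, at
a point where the profile and its derivative take the values `U` and `W`. -/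
def imagDensity (𝓔 c U W v v₁ v₂ : ℝ) : ℝ :=
  v₂ ^ 2 + 3 * U ^ 2 * v₁ ^ 2 + 3 * W ^ 2 * v ^ 2 + 4 * U * W * (v * v₁) + 3 / 2 * U ^ 4 * v ^ 2
    - (3 - 𝓔 ^ 2) / 2 * v ^ 2 - c * (v₁ ^ 2 - (1 - U ^ 2) * v ^ 2)

/-- The operator `L₋ v = -v'' - (1 - U²) v`, whose kernel contains the profile `U`. -/
def lMinus (U v v₂ : ℝ) : ℝ := -v₂ - (1 - U ^ 2) * v

/-- The Wronskian `U v' - U' v` of the profile and a perturbation. -/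
def profileWronskian (U W v v₁ : ℝ) : ℝ := U * v₁ - W * v

/-- Half the coefficient of `L₋ v · (U v' - U' v)` in the quadratic form equivalent to the density
at `c = 2 + δ`; the parameter `l` is the multiplicity of a null Lagrangian. -/
def imagCross (δ l U W : ℝ) : ℝ := δ * W / orbitWronskian U W - l * U ^ 2 * W

/-- The coefficient of `(U v' - U' v)²` that goes with `imagCross`. -/
def imagCoeff (δ l U W : ℝ) : ℝ :=
  1 - 2 * δ * U ^ 2 * W ^ 2 / orbitWronskian U W ^ 2 + l * (W ^ 2 - (1 - U ^ 2) * U ^ 2)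

variable {𝓔 : ℝ} {U W v v₁ v₂ : ℝ → ℝ}

theorem IsCnoidal.memW1_profileWronskian (h : IsCnoidal 𝓔 U W) (hv : MemW1 2 v v₁)
    (hv₁ : MemW1 2 v₁ v₂) :
    MemW1 2 (fun x => profileWronskian (U x) (W x) (v x) (v₁ x))
      (fun x => -U x * lMinus (U x) (v x) (v₂ x)) :=
  ((h.memW1.top_mul hv₁).sub (h.memW1_deriv.top_mul hv)).congr (fun _ => rfl)
    (fun x => by rw [lMinus]; ring)

theorem IsCnoidal.memW1_wronskian_deriv (h : IsCnoidal 𝓔 U W) (hv : MemW1 2 v v₁)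
    (hv₁ : MemW1 2 v₁ v₂) :
    MemW1 2 (fun x => W x * v₁ x + (1 - U x ^ 2) * U x * v x)
      (fun x => W x * (v₂ x + (1 - 3 * U x ^ 2) * v x)) :=
  ((h.memW1_deriv.top_mul hv₁).add ((h.memW1_one_sub_sq.top_mul h.memW1).top_mul hv)).congr
    (fun _ => rfl) (fun x => by ring)

theorem IsCnoidal.memW1_imagDensity_two (h : IsCnoidal 𝓔 U W) (hv : MemW1 2 v v₁)
    (hv₁ : MemW1 2 v₁ v₂) :
    MemW1 1 (fun x => U x * W x * (v x * v x) - 2 * ((1 - U x ^ 2) * (v x * v₁ x)))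
      (fun x => imagDensity 𝓔 2 (U x) (W x) (v x) (v₁ x) (v₂ x)
        - (lMinus (U x) (v x) (v₂ x) ^ 2 + profileWronskian (U x) (W x) (v x) (v₁ x) ^ 2)) := by
  refine (((h.memW1.top_mul h.memW1_deriv).top_mul (hv.mul_of_two hv)).sub
    ((h.memW1_one_sub_sq.top_mul (hv.mul_of_two hv₁)).const_mul 2)).congr (fun _ => rfl) fun x => ?_
  rw [imagDensity, lMinus, profileWronskian]
  linear_combination (-v x ^ 2) * h.energy x

theorem IsCnoidal.memW1_imag_energy (h : IsCnoidal 𝓔 U W) (h0 : 0 < 𝓔) (h1 : 𝓔 < 1)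
    (hv : MemW1 2 v v₁) (hv₁ : MemW1 2 v₁ v₂) :
    MemW1 1
      (fun x => W x * (orbitWronskian (U x) (W x))⁻¹ *
        (profileWronskian (U x) (W x) (v x) (v₁ x) * v₁ x
          - v x * (W x * v₁ x + (1 - U x ^ 2) * U x * v x)))
      (fun x => -(v₁ x ^ 2 - (1 - U x ^ 2) * v x ^ 2)
        - (2 * (W x / orbitWronskian (U x) (W x))
            * (lMinus (U x) (v x) (v₂ x) * profileWronskian (U x) (W x) (v x) (v₁ x))
          - 2 * U x ^ 2 * W x ^ 2 / orbitWronskian (U x) (W x) ^ 2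
            * profileWronskian (U x) (W x) (v x) (v₁ x) ^ 2)) := by
  refine ((h.memW1_deriv.top_mul (h.memW1_inv_orbitWronskian h0 h1)).top_mul
    (((h.memW1_profileWronskian hv hv₁).mul_of_two hv₁).sub
      (hv.mul_of_two (h.memW1_wronskian_deriv hv hv₁)))).congr (fun _ => rfl) fun x => ?_
  have hD := h.orbitWronskian_ne_zero h0 h1 x
  simp only [orbitWronskian, lMinus, profileWronskian] at hD ⊢
  field_simp
  ring

theorem IsCnoidal.memW1_profileWronskian_sq (h : IsCnoidal 𝓔 U W) (hv : MemW1 2 v v₁)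
    (hv₁ : MemW1 2 v₁ v₂) :
    MemW1 1
      (fun x => U x * W x * (profileWronskian (U x) (W x) (v x) (v₁ x)
        * profileWronskian (U x) (W x) (v x) (v₁ x)))
      (fun x => (W x ^ 2 - (1 - U x ^ 2) * U x ^ 2)
          * profileWronskian (U x) (W x) (v x) (v₁ x) ^ 2
        - 2 * (U x ^ 2 * W x)
          * (lMinus (U x) (v x) (v₂ x) * profileWronskian (U x) (W x) (v x) (v₁ x))) := by
  have hg := h.memW1_profileWronskian hv hv₁
  exact ((h.memW1.top_mul h.memW1_deriv).top_mul (hg.mul_of_two hg)).congr (fun _ => rfl)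
    fun x => by ring

theorem IsCnoidal.memLp_lMinus (h : IsCnoidal 𝓔 U W) (hv : MemLp v 2 volume)
    (hv₂ : MemLp v₂ 2 volume) : MemLp (fun x => lMinus (U x) (v x) (v₂ x)) 2 volume :=
  hv₂.neg.sub (hv.mul' h.memLp_top_one_sub_sq)

theorem IsCnoidal.integrable_imagDensity (h : IsCnoidal 𝓔 U W) (hv : MemW1 2 v v₁)
    (hv₁ : MemW1 2 v₁ v₂) (c : ℝ) :
    Integrable fun x => imagDensity 𝓔 c (U x) (W x) (v x) (v₁ x) (v₂ x) := by
  have hnull := memLp_one_iff_integrable.1 (h.memW1_imagDensity_two hv hv₁).memLp_deriv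
  have hf := (h.memLp_lMinus hv.memLp hv₁.memLp_deriv).integrable_sq
  have hg := (h.memW1_profileWronskian hv hv₁).memLp.integrable_sq
  have henergy := (h.integrable_energy hv.memLp hv.memLp_deriv 1).const_mul (2 - c)
  refine ((hnull.add (hf.add hg)).add henergy).congr (ae_of_all _ fun x => ?_)
  simp only [Pi.add_apply, imagDensity]
  ring

theorem IsCnoidal.integral_imagDensity_nonneg (h : IsCnoidal 𝓔 U W) (h0 : 0 < 𝓔) (h1 : 𝓔 < 1)
    {δ l : ℝ} (hdisc : ∀ x, imagCross δ l (U x) (W x) ^ 2 ≤ imagCoeff δ l (U x) (W x))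
    (hv : MemW1 2 v v₁) (hv₁ : MemW1 2 v₁ v₂) :
    0 ≤ ∫ x, imagDensity 𝓔 (2 + δ) (U x) (W x) (v x) (v₁ x) (v₂ x) := by
  have hnull := ((h.memW1_imagDensity_two hv hv₁).add
    ((h.memW1_imag_energy h0 h1 hv hv₁).const_mul δ)).sub
    ((h.memW1_profileWronskian_sq hv hv₁).const_mul l)
  refine hnull.integral_nonneg (h.integrable_imagDensity hv hv₁ _) fun x => ?_
  rw [← sub_nonneg]
  refine (sq_add_two_mul_add_nonneg (hdisc x) (lMinus (U x) (v x) (v₂ x))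
    (profileWronskian (U x) (W x) (v x) (v₁ x))).trans_eq ?_
  rw [imagCross, imagCoeff, imagDensity, imagDensity]
  ring

end ImaginaryPerturbations

section RealPerturbations

/-- Half the quadratic density of the second variation on real perturbations `u`, at a point where
the profile and its derivative take the values `U` and `W`. -/
def realDensity (𝓔 c U W u u₁ u₂ : ℝ) : ℝ :=
  u₂ ^ 2 + 5 * U ^ 2 * u₁ ^ 2 + 5 * W ^ 2 * u ^ 2 + 20 * U * W * (u * u₁) + 15 / 2 * U ^ 4 * u ^ 2
    - (3 - 𝓔 ^ 2) / 2 * u ^ 2 - c * (u₁ ^ 2 - (1 - 3 * U ^ 2) * u ^ 2)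

/-- A second-order operator annihilating `U'`, which plays for real perturbations the role of
`lMinus`. -/
def realOperator (U W u u₁ u₂ : ℝ) : ℝ := -u₂ - U * W / (1 - U ^ 2) * u₁ - (1 - 2 * U ^ 2) * u

/-- The Wronskian `U' u' - U'' u` divided by `1 - U²`, which plays for real perturbations the role
of `profileWronskian`. -/
def derivWronskian (U W u u₁ : ℝ) : ℝ := W / (1 - U ^ 2) * u₁ + U * u

/-- The counterpart of `imagCross` for real perturbations. -/
def realCross (δ l U W : ℝ) : ℝ :=
  -(δ * U * (1 - U ^ 2) / orbitWronskian U W) + l * U * W ^ 2 / (1 - U ^ 2)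

/-- The counterpart of `imagCoeff` for real perturbations. -/
def realCoeff (δ l U W : ℝ) : ℝ :=
  1 + 2 * δ * (-(U ^ 2 * (1 - U ^ 2) / orbitWronskian U W)
      + (U ^ 2 * (1 - U ^ 2) / orbitWronskian U W) ^ 2)
    - l * (W ^ 2 - (1 - U ^ 2) * U ^ 2) - 2 * l * U ^ 2 * W ^ 2 / (1 - U ^ 2)

variable {𝓔 : ℝ} {U W u u₁ u₂ : ℝ → ℝ}

theorem IsCnoidal.memW1_derivWronskian (h : IsCnoidal 𝓔 U W) (h0 : 0 < 𝓔) (hu : MemW1 2 u u₁)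
    (hu₁ : MemW1 2 u₁ u₂) :
    MemW1 2 (fun x => derivWronskian (U x) (W x) (u x) (u₁ x))
      (fun x => -(W x / (1 - U x ^ 2)) * realOperator (U x) (W x) (u x) (u₁ x) (u₂ x)
        + U x * W x / (1 - U x ^ 2) * derivWronskian (U x) (W x) (u x) (u₁ x)) := by
  refine (((h.memW1_deriv.top_mul (h.memW1_inv_one_sub_sq h0)).top_mul hu₁).add
    (h.memW1.top_mul hu)).congr (fun _ => rfl) fun x => ?_
  have hb : 1 - U x ^ 2 ≠ 0 := (h0.trans_le (h.le_one_sub_sq x)).ne'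
  simp only [realOperator, derivWronskian]
  field_simp
  ring

theorem IsCnoidal.memW1_realDensity_two (h : IsCnoidal 𝓔 U W) (h0 : 0 < 𝓔) (hu : MemW1 2 u u₁)
    (hu₁ : MemW1 2 u₁ u₂) :
    MemW1 1
      (fun x => 4 * (U x * W x * (u x * u x)) - (2 * u x - 4 * (U x * (U x * u x))) * u₁ x
        - U x * W x * (1 - U x ^ 2)⁻¹ * (u₁ x * u₁ x))
      (fun x => realDensity 𝓔 2 (U x) (W x) (u x) (u₁ x) (u₂ x)
        - (realOperator (U x) (W x) (u x) (u₁ x) (u₂ x) ^ 2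
          + derivWronskian (U x) (W x) (u x) (u₁ x) ^ 2)) := by
  have hUW := h.memW1.top_mul h.memW1_deriv
  have hmid := (hu.const_mul 2).sub ((h.memW1.top_mul (h.memW1.top_mul hu)).const_mul 4)
  refine ((((hUW.top_mul (hu.mul_of_two hu)).const_mul 4).sub (hmid.mul_of_two hu₁)).sub
    ((hUW.top_mul (h.memW1_inv_one_sub_sq h0)).top_mul (hu₁.mul_of_two hu₁))).congr
    (fun _ => rfl) fun x => ?_
  have hb : 1 - U x ^ 2 ≠ 0 := (h0.trans_le (h.le_one_sub_sq x)).ne'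
  have h𝓔 : 𝓔 ^ 2 = (1 - U x ^ 2) ^ 2 - 2 * W x ^ 2 := by linarith [h.energy x]
  rw [realDensity, realOperator, derivWronskian, h𝓔]
  field_simp
  ring

theorem IsCnoidal.memW1_real_energy (h : IsCnoidal 𝓔 U W) (h0 : 0 < 𝓔) (h1 : 𝓔 < 1)
    (hu : MemW1 2 u u₁) (hu₁ : MemW1 2 u₁ u₂) :
    MemW1 1
      (fun x => -1 * (U x * (orbitWronskian (U x) (W x))⁻¹ *
        ((1 - U x ^ 2) * u x * (profileWronskian (U x) (W x) (u x) (u₁ x))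
          + u₁ x * (W x * u₁ x + (1 - U x ^ 2) * U x * u x))))
      (fun x => -(u₁ x ^ 2 - (1 - 3 * U x ^ 2) * u x ^ 2)
        - (2 * -(U x * (1 - U x ^ 2) / orbitWronskian (U x) (W x))
            * (realOperator (U x) (W x) (u x) (u₁ x) (u₂ x)
              * derivWronskian (U x) (W x) (u x) (u₁ x))
          + 2 * (-(U x ^ 2 * (1 - U x ^ 2) / orbitWronskian (U x) (W x))
              + (U x ^ 2 * (1 - U x ^ 2) / orbitWronskian (U x) (W x)) ^ 2)
            * derivWronskian (U x) (W x) (u x) (u₁ x) ^ 2)) := by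
  have hbu := h.memW1_one_sub_sq.top_mul hu
  refine (((h.memW1.top_mul (h.memW1_inv_orbitWronskian h0 h1)).top_mul
    ((hbu.mul_of_two (h.memW1_profileWronskian hu hu₁)).add
      (hu₁.mul_of_two (h.memW1_wronskian_deriv hu hu₁)))).const_mul (-1)).congr
    (fun _ => rfl) fun x => ?_
  have hb : 1 - U x ^ 2 ≠ 0 := (h0.trans_le (h.le_one_sub_sq x)).ne'
  have hD := h.orbitWronskian_ne_zero h0 h1 x
  simp only [orbitWronskian, lMinus, profileWronskian, realOperator, derivWronskian] at hD ⊢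
  field_simp
  ring

theorem IsCnoidal.memW1_derivWronskian_sq (h : IsCnoidal 𝓔 U W) (h0 : 0 < 𝓔) (hu : MemW1 2 u u₁)
    (hu₁ : MemW1 2 u₁ u₂) :
    MemW1 1
      (fun x => U x * W x * (derivWronskian (U x) (W x) (u x) (u₁ x)
        * derivWronskian (U x) (W x) (u x) (u₁ x)))
      (fun x => (W x ^ 2 - (1 - U x ^ 2) * U x ^ 2 + 2 * U x ^ 2 * W x ^ 2 / (1 - U x ^ 2))
          * derivWronskian (U x) (W x) (u x) (u₁ x) ^ 2
        - 2 * (U x * W x ^ 2 / (1 - U x ^ 2))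
          * (realOperator (U x) (W x) (u x) (u₁ x) (u₂ x)
            * derivWronskian (U x) (W x) (u x) (u₁ x))) := by
  have hG := h.memW1_derivWronskian h0 hu hu₁
  exact ((h.memW1.top_mul h.memW1_deriv).top_mul (hG.mul_of_two hG)).congr (fun _ => rfl)
    fun x => by ring

theorem IsCnoidal.memLp_realOperator (h : IsCnoidal 𝓔 U W) (h0 : 0 < 𝓔) (hu : MemLp u 2 volume)
    (hu₁ : MemLp u₁ 2 volume) (hu₂ : MemLp u₂ 2 volume) :
    MemLp (fun x => realOperator (U x) (W x) (u x) (u₁ x) (u₂ x)) 2 volume := by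
  have hcoeff := (h.memW1.top_mul h.memW1_deriv).top_mul (h.memW1_inv_one_sub_sq h0)
  have hUUu : MemLp (fun x => U x * (U x * u x)) 2 volume :=
    (hu.mul' h.memLp_top (r := 2)).mul' h.memLp_top
  convert (hu₂.neg.sub (hu₁.mul' hcoeff.memLp (r := 2))).sub (hu.sub (hUUu.const_mul 2)) using 2
    with x
  simp only [realOperator, Pi.sub_apply, Pi.neg_apply]
  ring

theorem IsCnoidal.integrable_realDensity (h : IsCnoidal 𝓔 U W) (h0 : 0 < 𝓔) (hu : MemW1 2 u u₁)
    (hu₁ : MemW1 2 u₁ u₂) (c : ℝ) :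
    Integrable fun x => realDensity 𝓔 c (U x) (W x) (u x) (u₁ x) (u₂ x) := by
  have hnull := memLp_one_iff_integrable.1 (h.memW1_realDensity_two h0 hu hu₁).memLp_deriv
  have hF := (h.memLp_realOperator h0 hu.memLp hu₁.memLp hu₁.memLp_deriv).integrable_sq
  have hG := (h.memW1_derivWronskian h0 hu hu₁).memLp.integrable_sq
  have henergy := (h.integrable_energy hu.memLp hu.memLp_deriv 3).const_mul (2 - c)
  refine ((hnull.add (hF.add hG)).add henergy).congr (ae_of_all _ fun x => ?_)
  simp only [Pi.add_apply, realDensity]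
  ring

theorem IsCnoidal.integral_realDensity_nonneg (h : IsCnoidal 𝓔 U W) (h0 : 0 < 𝓔) (h1 : 𝓔 < 1)
    {δ l : ℝ} (hdisc : ∀ x, realCross δ l (U x) (W x) ^ 2 ≤ realCoeff δ l (U x) (W x))
    (hu : MemW1 2 u u₁) (hu₁ : MemW1 2 u₁ u₂) :
    0 ≤ ∫ x, realDensity 𝓔 (2 + δ) (U x) (W x) (u x) (u₁ x) (u₂ x) := by
  have hnull := ((h.memW1_realDensity_two h0 hu hu₁).add
    ((h.memW1_real_energy h0 h1 hu hu₁).const_mul δ)).add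
    ((h.memW1_derivWronskian_sq h0 hu hu₁).const_mul l)
  refine hnull.integral_nonneg (h.integrable_realDensity h0 hu hu₁ _) fun x => ?_
  rw [← sub_nonneg]
  refine (sq_add_two_mul_add_nonneg (hdisc x) (realOperator (U x) (W x) (u x) (u₁ x) (u₂ x))
    (derivWronskian (U x) (W x) (u x) (u₁ x))).trans_eq ?_
  rw [realCross, realCoeff, realDensity, realDensity]
  ring

end RealPerturbations

section Discriminants

variable {r d y z : ℝ}

theorem abs_le_three_halves (hd : d ^ 2 ≤ 2) : |d| ≤ 3 / 2 :=
  abs_le_of_sq_le_sq (hd.trans (by norm_num)) (by norm_num)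

theorem mul_sub_sq_le {X X' t j : ℝ} (hr : 0 ≤ r) (hr' : r ≤ 1 / 100) (hd : d ^ 2 ≤ 2)
    (hX : 0 ≤ X) (hX' : 0 ≤ X') (hXX' : X + X' ≤ 1) (ht : 0 ≤ t) (ht' : t ≤ 1 + 2 * r ^ 2)
    (hj : 0 ≤ j) (hj' : j ≤ 2) :
    X * (d * t - r * d ^ 2 * X' * j / 2) ^ 2 ≤ d ^ 2 * X + 3 * r := by
  set B := r * d ^ 2 * X' * j / 2
  have : 0 ≤ B := by positivity
  have hB' : B ≤ 2 * r * X' := by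
    calc B ≤ r * 2 * X' * 2 / 2 := by unfold B; gcongr
      _ = 2 * r * X' := by ring
  have hrr : r ^ 2 ≤ r / 100 := by nlinarith
  have hXX : X' * X ≤ 1 / 4 := by nlinarith [sq_nonneg (X - X')]
  have hmain : X * (d * t) ^ 2 ≤ d ^ 2 * X + r := by
    calc X * (d * t) ^ 2 ≤ X * (d * (1 + 2 * r ^ 2)) ^ 2 := by rw [mul_pow, mul_pow]; gcongr
      _ = d ^ 2 * X + d ^ 2 * X * (4 * r ^ 2 + 4 * r ^ 2 * r ^ 2) := by ring
      _ ≤ d ^ 2 * X + 2 * 1 * (4 * r ^ 2 + 4 * r ^ 2 * 1) := by gcongr <;> nlinarith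
      _ ≤ d ^ 2 * X + r := by linarith
  have hcross : -(d * t) * (B * X) ≤ r * (4 / 5) := by
    calc -(d * t) * (B * X) ≤ |d| * t * (B * X) := by
          rw [← neg_mul]; gcongr; exact neg_le_abs d
      _ ≤ 3 / 2 * (1 + 2 * r ^ 2) * (2 * r * X' * X) := by
          gcongr; exact abs_le_three_halves hd
      _ = 3 * r * (1 + 2 * r ^ 2) * (X' * X) := by ring
      _ ≤ 3 * r * (16 / 15) * (1 / 4) := by gcongr; linarith
      _ = r * (4 / 5) := by ring
  have hsq : X * B ^ 2 ≤ r * (2 / 5) := by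
    calc X * B ^ 2 ≤ 1 * (2 * r * 1) ^ 2 := by gcongr <;> nlinarith
      _ ≤ r * (2 / 5) := by linarith
  linear_combination hmain + 2 * hcross + hsq

theorem rescaled_orbit_bounds (hy : y ^ 2 ≤ 1)
    (hz : z ^ 2 = (1 - y ^ 2) * (1 - r ^ 2 * (1 + y ^ 2) / 2)) :
    (1 - y ^ 2) * (1 - r ^ 2) ≤ z ^ 2 ∧ y ^ 2 + z ^ 2 ≤ 1 := by
  have hloss : 0 ≤ (1 - y ^ 2) * r ^ 2 := mul_nonneg (sub_nonneg.2 hy) (sq_nonneg r)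
  constructor <;> nlinarith [mul_nonneg hloss (sub_nonneg.2 hy), mul_nonneg hloss (sq_nonneg y)]

/-- The value of `orbitWronskian` in the variables `y = U / r`, `z = U' / r`, divided by `r²`. -/
def rescaledWronskian (r y z : ℝ) : ℝ := z ^ 2 + y ^ 2 - r ^ 2 * y ^ 4

theorem orbitWronskian_rescaled (r y z : ℝ) :
    orbitWronskian (r * y) (r * z) = r ^ 2 * rescaledWronskian r y z := by
  rw [orbitWronskian, rescaledWronskian]
  ring

theorem rescaledWronskian_eq (hz : z ^ 2 = (1 - y ^ 2) * (1 - r ^ 2 * (1 + y ^ 2) / 2)) :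
    rescaledWronskian r y z = 1 - r ^ 2 * (1 + y ^ 4) / 2 := by
  rw [rescaledWronskian, hz]
  ring

theorem inv_rescaledWronskian_mem_Icc (hr : 0 ≤ r) (hr' : r ≤ 1 / 100) (hy : y ^ 2 ≤ 1)
    (hz : z ^ 2 = (1 - y ^ 2) * (1 - r ^ 2 * (1 + y ^ 2) / 2)) :
    (rescaledWronskian r y z)⁻¹ ∈ Icc 1 (1 + 2 * r ^ 2) := by
  rw [rescaledWronskian_eq hz]
  have hy4 : y ^ 4 ≤ 1 := by nlinarith [sq_nonneg y]
  have hrr : r ^ 2 ≤ 1 / 10000 := by nlinarith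
  have hlower : 1 - r ^ 2 ≤ 1 - r ^ 2 * (1 + y ^ 4) / 2 := by
    nlinarith [mul_nonneg (sq_nonneg r) (sub_nonneg.2 hy4)]
  refine ⟨(one_le_inv₀ (by linarith)).2 (sub_le_self _ (by positivity)), ?_⟩
  rw [inv_le_comm₀ (by linarith) (by positivity)]
  refine (inv_le_of_inv_le₀ (by linarith) ?_).trans hlower
  rw [inv_le_iff_one_le_mul₀ (by linarith)]
  nlinarith [sq_nonneg r]

theorem rescaled_one_sub_sq_bounds (hr : 0 ≤ r) (hr' : r ≤ 1 / 100) (hy : y ^ 2 ≤ 1) :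
    0 < 1 - (r * y) ^ 2 ∧ 1 - (r * y) ^ 2 ≤ 1 ∧ (1 - (r * y) ^ 2)⁻¹ ≤ 2 := by
  have hry : (r * y) ^ 2 ≤ (1 / 100) ^ 2 * 1 := by rw [mul_pow]; gcongr
  refine ⟨by linarith, sub_le_self _ (sq_nonneg _), ?_⟩
  rw [inv_le_comm₀ (by linarith) two_pos]
  linarith

theorem exists_rescaling {δ U W : ℝ} (hr : 0 < r) (hδ : δ ^ 2 ≤ 2 * r ^ 2 * (1 - 10 * r))
    (hU : U ^ 2 ≤ r ^ 2) (hW : W ^ 2 = ((1 - U ^ 2) ^ 2 - (1 - r ^ 2) ^ 2) / 2) :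
    ∃ d y z : ℝ, δ = r * d ∧ U = r * y ∧ W = r * z ∧ d ^ 2 ≤ 2 * (1 - 10 * r) ∧ y ^ 2 ≤ 1 ∧
      z ^ 2 = (1 - y ^ 2) * (1 - r ^ 2 * (1 + y ^ 2) / 2) := by
  refine ⟨δ / r, U / r, W / r, (mul_div_cancel₀ δ hr.ne').symm, (mul_div_cancel₀ U hr.ne').symm,
    (mul_div_cancel₀ W hr.ne').symm, ?_, ?_, ?_⟩
  · rw [div_pow, div_le_iff₀ (by positivity)]
    linarith
  · rwa [div_pow, div_le_one (by positivity)]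
  · rw [div_pow, hW]
    field_simp
    ring

theorem imagCross_rescaled (hr : r ≠ 0) :
    imagCross (r * d) (d ^ 2 / (2 * r ^ 2)) (r * y) (r * z) ^ 2
      = z ^ 2 * (d * (rescaledWronskian r y z)⁻¹ - r * d ^ 2 * y ^ 2 * 1 / 2) ^ 2 := by
  rw [imagCross, orbitWronskian_rescaled]
  field_simp

theorem imagCoeff_rescaled (hr : r ≠ 0) :
    imagCoeff (r * d) (d ^ 2 / (2 * r ^ 2)) (r * y) (r * z)
      = 1 - 2 * r * d * (y ^ 2 * z ^ 2) * (rescaledWronskian r y z)⁻¹ ^ 2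
        + d ^ 2 / 2 * (z ^ 2 - y ^ 2 + r ^ 2 * y ^ 4) := by
  rw [imagCoeff, orbitWronskian_rescaled]
  field_simp
  ring

theorem realCross_rescaled (hr : r ≠ 0) :
    realCross (r * d) (d ^ 2 / (2 * r ^ 2)) (r * y) (r * z) ^ 2
      = y ^ 2 * (d * ((1 - (r * y) ^ 2) * (rescaledWronskian r y z)⁻¹)
        - r * d ^ 2 * z ^ 2 * (1 - (r * y) ^ 2)⁻¹ / 2) ^ 2 := by
  rw [realCross, orbitWronskian_rescaled, div_eq_mul_inv _ (1 - _)]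
  field_simp
  ring

theorem realCoeff_rescaled (hr : r ≠ 0) :
    realCoeff (r * d) (d ^ 2 / (2 * r ^ 2)) (r * y) (r * z)
      = 1 + 2 * r * d * (-(y ^ 2 * ((1 - (r * y) ^ 2) * (rescaledWronskian r y z)⁻¹))
          + (y ^ 2 * ((1 - (r * y) ^ 2) * (rescaledWronskian r y z)⁻¹)) ^ 2)
        - d ^ 2 / 2 * (z ^ 2 - y ^ 2 + r ^ 2 * y ^ 4)
        - r ^ 2 * d ^ 2 * (y ^ 2 * z ^ 2) * (1 - (r * y) ^ 2)⁻¹ := by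
  rw [realCoeff, orbitWronskian_rescaled, div_eq_mul_inv _ (1 - (r * y) ^ 2)]
  field_simp
  ring

theorem le_imagCoeff_rescaled (hr : 0 < r) (hr' : r ≤ 1 / 100) (hd : d ^ 2 ≤ 2) (hy : y ^ 2 ≤ 1)
    (hz : z ^ 2 = (1 - y ^ 2) * (1 - r ^ 2 * (1 + y ^ 2) / 2)) :
    1 - d ^ 2 / 2 + d ^ 2 * (1 - y ^ 2) - 2 * r
      ≤ imagCoeff (r * d) (d ^ 2 / (2 * r ^ 2)) (r * y) (r * z) := by
  obtain ⟨hzl, hzu⟩ := rescaled_orbit_bounds hy hz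
  obtain ⟨he, he'⟩ := inv_rescaledWronskian_mem_Icc hr.le hr' hy hz
  rw [imagCoeff_rescaled hr.ne']
  set e := (rescaledWronskian r y z)⁻¹
  have hrr : r ^ 2 ≤ r / 100 := by nlinarith
  have hyz : y ^ 2 * z ^ 2 ≤ 1 / 4 := by nlinarith [sq_nonneg (y ^ 2 - z ^ 2)]
  have hspeed : d * (y ^ 2 * z ^ 2 * e ^ 2) ≤ 1 / 2 := by
    calc d * (y ^ 2 * z ^ 2 * e ^ 2) ≤ 3 / 2 * (1 / 4 * (16 / 15) ^ 2) := by
          gcongr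
          · exact (le_abs_self d).trans (abs_le_three_halves hd)
          · linarith
      _ ≤ 1 / 2 := by norm_num
  have hloss : d ^ 2 * (1 - y ^ 2) * r ^ 2 ≤ 2 * 1 * r ^ 2 := by
    gcongr
    linarith [sq_nonneg y]
  have hquartic : 0 ≤ d ^ 2 * (r ^ 2 * y ^ 4) := by positivity
  nlinarith [mul_le_mul_of_nonneg_left hzl (sq_nonneg d)]

theorem le_realCoeff_rescaled (hr : 0 < r) (hr' : r ≤ 1 / 100) (hd : d ^ 2 ≤ 2) (hy : y ^ 2 ≤ 1)
    (hz : z ^ 2 = (1 - y ^ 2) * (1 - r ^ 2 * (1 + y ^ 2) / 2)) :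
    1 - d ^ 2 / 2 + d ^ 2 * y ^ 2 - 2 * r
      ≤ realCoeff (r * d) (d ^ 2 / (2 * r ^ 2)) (r * y) (r * z) := by
  have hzu := (rescaled_orbit_bounds hy hz).2
  obtain ⟨he, he'⟩ := inv_rescaledWronskian_mem_Icc hr.le hr' hy hz
  rw [realCoeff_rescaled hr.ne']
  set e := (rescaledWronskian r y z)⁻¹
  set b := 1 - (r * y) ^ 2
  have hrr : r ^ 2 ≤ r / 100 := by nlinarith
  have hyz : y ^ 2 * z ^ 2 ≤ 1 / 4 := by nlinarith [sq_nonneg (y ^ 2 - z ^ 2)]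
  obtain ⟨hb0, hb1, hbinv⟩ := rescaled_one_sub_sq_bounds hr.le hr' hy
  have hs0 : 0 ≤ y ^ 2 * (b * e) := by positivity
  have hs1 : y ^ 2 * (b * e) ≤ 1 * (1 * (1 + 2 * r ^ 2)) := by gcongr
  set s := y ^ 2 * (b * e)
  have hss : |-s + s ^ 2| ≤ 1 / 3 := abs_le.2 ⟨by nlinarith [sq_nonneg (s - 1 / 2)], by nlinarith⟩
  have hspeed : -(d * (-s + s ^ 2)) ≤ 1 / 2 := by
    calc -(d * (-s + s ^ 2)) ≤ |d| * |-s + s ^ 2| := abs_mul d _ ▸ neg_le_abs _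
      _ ≤ 3 / 2 * (1 / 3) := by gcongr; exact abs_le_three_halves hd
      _ = 1 / 2 := by norm_num
  have hmixed : d ^ 2 * (y ^ 2 * z ^ 2) * b⁻¹ ≤ 2 * (1 / 4) * 2 := by gcongr
  have hquartic : d ^ 2 * y ^ 4 ≤ 2 * 1 := by
    gcongr
    exact (pow_mul y 2 2).trans_le (pow_le_one₀ (sq_nonneg y) hy)
  have hzd : d ^ 2 * z ^ 2 ≤ d ^ 2 * (1 - y ^ 2) := by gcongr; linarith
  linear_combination 2 * r * hspeed + r ^ 2 * hmixed + r ^ 2 / 2 * hquartic + hzd / 2 + 2 * hrr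
    + 49 / 50 * hr

theorem imagCross_sq_le_imagCoeff {δ U W : ℝ} (hr : 0 < r) (hr' : r ≤ 1 / 100)
    (hδ : δ ^ 2 ≤ 2 * r ^ 2 * (1 - 10 * r)) (hU : U ^ 2 ≤ r ^ 2)
    (hW : W ^ 2 = ((1 - U ^ 2) ^ 2 - (1 - r ^ 2) ^ 2) / 2) :
    imagCross δ (δ ^ 2 / (2 * r ^ 4)) U W ^ 2 ≤ imagCoeff δ (δ ^ 2 / (2 * r ^ 4)) U W := by
  obtain ⟨d, y, z, rfl, rfl, rfl, hd, hy, hz⟩ := exists_rescaling hr hδ hU hW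
  have hd2 : d ^ 2 ≤ 2 := by linarith
  have hl : (r * d) ^ 2 / (2 * r ^ 4) = d ^ 2 / (2 * r ^ 2) := by field_simp
  obtain ⟨he, he'⟩ := inv_rescaledWronskian_mem_Icc hr.le hr' hy hz
  have hyz := (rescaled_orbit_bounds hy hz).2
  rw [hl, imagCross_rescaled hr.ne']
  have hcross := mul_sub_sq_le hr.le hr' hd2 (sq_nonneg z) (sq_nonneg y) (by linarith)
    (zero_le_one.trans he) he' zero_le_one one_le_two
  have hzd : d ^ 2 * z ^ 2 ≤ d ^ 2 * (1 - y ^ 2) := by gcongr; linarith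
  linarith [le_imagCoeff_rescaled hr hr' hd2 hy hz]

theorem realCross_sq_le_realCoeff {δ U W : ℝ} (hr : 0 < r) (hr' : r ≤ 1 / 100)
    (hδ : δ ^ 2 ≤ 2 * r ^ 2 * (1 - 10 * r)) (hU : U ^ 2 ≤ r ^ 2)
    (hW : W ^ 2 = ((1 - U ^ 2) ^ 2 - (1 - r ^ 2) ^ 2) / 2) :
    realCross δ (δ ^ 2 / (2 * r ^ 4)) U W ^ 2 ≤ realCoeff δ (δ ^ 2 / (2 * r ^ 4)) U W := by
  obtain ⟨d, y, z, rfl, rfl, rfl, hd, hy, hz⟩ := exists_rescaling hr hδ hU hW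
  have hd2 : d ^ 2 ≤ 2 := by linarith
  have hl : (r * d) ^ 2 / (2 * r ^ 4) = d ^ 2 / (2 * r ^ 2) := by field_simp
  obtain ⟨he, he'⟩ := inv_rescaledWronskian_mem_Icc hr.le hr' hy hz
  obtain ⟨hb0, hb1, hbinv⟩ := rescaled_one_sub_sq_bounds hr.le hr' hy
  have he0 := zero_le_one.trans he
  rw [hl, realCross_rescaled hr.ne']
  have hcross := mul_sub_sq_le hr.le hr' hd2 (sq_nonneg y) (sq_nonneg z)
    (rescaled_orbit_bounds hy hz).2 (mul_nonneg hb0.le he0)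
    ((mul_le_of_le_one_left he0 hb1).trans he') (inv_nonneg.2 hb0.le) hbinv
  linarith [le_realCoeff_rescaled hr hr' hd2 hy hz]

end Discriminants

section SecondVariation

open Polynomial

theorem iteratedDeriv_two_eval (P : ℝ[X]) (a : ℝ) :
    iteratedDeriv 2 (fun ε => P.eval ε) a = P.derivative.derivative.eval a := by
  have hderiv : deriv (fun ε => P.eval ε) = fun ε => P.derivative.eval ε := funext fun _ => P.deriv
  rw [iteratedDeriv_succ, iteratedDeriv_one, hderiv, Polynomial.deriv]

theorem lambdaDensity_mk (𝓔 c p₁ p₂ q₁ q₂ r₁ r₂ : ℝ) :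
    lambdaDensity 𝓔 c ⟨p₁, p₂⟩ ⟨q₁, q₂⟩ ⟨r₁, r₂⟩ =
      r₁ ^ 2 + r₂ ^ 2 + 3 * (p₁ ^ 2 + p₂ ^ 2) * (q₁ ^ 2 + q₂ ^ 2) + 2 * (p₁ * q₁ + p₂ * q₂) ^ 2
        + (p₁ ^ 2 + p₂ ^ 2) ^ 3 / 2 - (3 - 𝓔 ^ 2) / 2 * (p₁ ^ 2 + p₂ ^ 2)
        - c * (q₁ ^ 2 + q₂ ^ 2 + (1 - (p₁ ^ 2 + p₂ ^ 2)) ^ 2 / 2) := by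
  have hsix (z : ℂ) : ‖z‖ ^ 6 = (‖z‖ ^ 2) ^ 3 := by ring
  simp only [lambdaDensity, actionDensity, higherDensity, chargeDensity, energyDensity, hsix,
    Complex.sq_norm, Complex.normSq_mk, Complex.add_re, Complex.mul_re, Complex.conj_re,
    Complex.conj_im]
  ring

theorem secondVariationDensity_eq (𝓔 c : ℝ) (w w₁ w₂ : ℝ → ℂ) (x : ℝ) :
    secondVariationDensity 𝓔 c w w₁ w₂ x =
      2 * (realDensity 𝓔 c (profile 𝓔 x) (deriv (profile 𝓔) x) (w x).re (w₁ x).re (w₂ x).re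
        + imagDensity 𝓔 c (profile 𝓔 x) (deriv (profile 𝓔) x) (w x).im (w₁ x).im (w₂ x).im) := by
  rw [secondVariationDensity]
  generalize profile 𝓔 x = U
  generalize deriv (profile 𝓔) x = W
  generalize deriv (deriv (profile 𝓔)) x = X₂
  obtain ⟨u, v⟩ := w x
  obtain ⟨u₁, v₁⟩ := w₁ x
  obtain ⟨u₂, v₂⟩ := w₂ x
  have hline (a b₁ b₂ ε : ℝ) : (a : ℂ) + ε • (⟨b₁, b₂⟩ : ℂ) = ⟨a + b₁ * ε, b₂ * ε⟩ := by
    apply Complex.ext <;> simp [mul_comm]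
  let normSq (a b₁ b₂ : ℝ) : ℝ[X] := (C a + C b₁ * X) ^ 2 + (C b₂ * X) ^ 2
  let P : ℝ[X] := normSq X₂ u₂ v₂ + 3 * normSq U u v * normSq W u₁ v₁
    + 2 * ((C U + C u * X) * (C W + C u₁ * X) + C v * X * (C v₁ * X)) ^ 2
    + C (1 / 2) * normSq U u v ^ 3 - C ((3 - 𝓔 ^ 2) / 2) * normSq U u v
    - C c * (normSq W u₁ v₁ + C (1 / 2) * (1 - normSq U u v) ^ 2)
  have hP (ε : ℝ) : lambdaDensity 𝓔 c ((U : ℂ) + ε • ⟨u, v⟩) ((W : ℂ) + ε • ⟨u₁, v₁⟩)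
      ((X₂ : ℂ) + ε • ⟨u₂, v₂⟩) = P.eval ε := by
    simp only [hline, lambdaDensity_mk, P, normSq, eval_add, eval_sub, eval_mul, eval_pow, eval_C,
      eval_X, eval_one, eval_ofNat]
    ring
  simp only [hP, iteratedDeriv_two_eval]
  simp only [P, normSq, realDensity, imagDensity, one_div, derivative_sub, derivative_add,
    derivative_pow, derivative_mul, derivative_C, derivative_X, derivative_ofNat, derivative_one,
    derivative_neg, Nat.cast_ofNat, Nat.add_one_sub_one, pow_one, zero_mul, mul_zero, mul_one,
    zero_add, add_zero, zero_sub, eval_add, eval_sub, eval_neg, eval_mul, eval_pow,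
    eval_C, eval_X, eval_ofNat, eval_one]
  ring

theorem IsH2.memW1_comp {w w₁ w₂ : ℝ → ℂ} (h : IsH2 w w₁ w₂) (L : ℂ →L[ℝ] ℝ) :
    MemW1 2 (fun x => L (w x)) (fun x => L (w₁ x)) ∧
      MemW1 2 (fun x => L (w₁ x)) (fun x => L (w₂ x)) := by
  have hloc {f : ℝ → ℂ} (hf : MemLp f 2 volume) : LocallyIntegrable f :=
    hf.locallyIntegrable one_le_two
  exact ⟨(IsWeakDeriv.clm_comp h.weak_fst (hloc h.memLp) (hloc h.memLp_fst) L).memW1 one_le_two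
      (L.comp_memLp' h.memLp) (L.comp_memLp' h.memLp_fst),
    (IsWeakDeriv.clm_comp h.weak_snd (hloc h.memLp_fst) (hloc h.memLp_snd) L).memW1 one_le_two
      (L.comp_memLp' h.memLp_fst) (L.comp_memLp' h.memLp_snd)⟩

theorem secondVariation_nonneg {𝓔 c : ℝ} (h0 : 1 - 1 / 10000 ≤ 𝓔) (h1 : 𝓔 < 1)
    (hc : (c - 2) ^ 2 ≤ 2 * (1 - 𝓔) * (1 - 10 * √(1 - 𝓔))) {w w₁ w₂ : ℝ → ℂ}
    (hw : IsH2 w w₁ w₂) :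
    Integrable (secondVariationDensity 𝓔 c w w₁ w₂) ∧ 0 ≤ secondVariation 𝓔 c w w₁ w₂ := by
  obtain ⟨δ, rfl⟩ : ∃ δ, c = 2 + δ := ⟨c - 2, by ring⟩
  have h𝓔 : 0 < 𝓔 := by linarith
  have hr : 0 < √(1 - 𝓔) := Real.sqrt_pos.2 (sub_pos.2 h1)
  have hr' : √(1 - 𝓔) ≤ 1 / 100 := Real.sqrt_le_iff.2 ⟨by norm_num, by linarith⟩
  have hsq : √(1 - 𝓔) ^ 2 = 1 - 𝓔 := Real.sq_sqrt (sub_pos.2 h1).le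
  have hδ : δ ^ 2 ≤ 2 * √(1 - 𝓔) ^ 2 * (1 - 10 * √(1 - 𝓔)) := by
    rwa [hsq, ← add_sub_cancel_left 2 δ]
  have hprofile := isCnoidal_profile h𝓔 h1.le
  have hU (x : ℝ) : profile 𝓔 x ^ 2 ≤ √(1 - 𝓔) ^ 2 := (hprofile.sq_le x).trans_eq hsq.symm
  have hW (x : ℝ) : deriv (profile 𝓔) x ^ 2 =
      ((1 - profile 𝓔 x ^ 2) ^ 2 - (1 - √(1 - 𝓔) ^ 2) ^ 2) / 2 := by
    rw [hsq, sub_sub_cancel, hprofile.energy]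
  obtain ⟨hre, hre₁⟩ := hw.memW1_comp Complex.reCLM
  obtain ⟨him, him₁⟩ := hw.memW1_comp Complex.imCLM
  have integrable_re := hprofile.integrable_realDensity h𝓔 hre hre₁ (2 + δ)
  have integrable_im := hprofile.integrable_imagDensity him him₁ (2 + δ)
  have integral_re := hprofile.integral_realDensity_nonneg h𝓔 h1
    (fun x => realCross_sq_le_realCoeff hr hr' hδ (hU x) (hW x)) hre hre₁
  have integral_im := hprofile.integral_imagDensity_nonneg h𝓔 h1
    (fun x => imagCross_sq_le_imagCoeff hr hr' hδ (hU x) (hW x)) him him₁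
  rw [secondVariation, funext (secondVariationDensity_eq 𝓔 (2 + δ) w w₁ w₂)]
  refine ⟨(integrable_re.fun_add integrable_im).const_mul 2, ?_⟩
  rw [integral_const_mul]
  exact mul_nonneg zero_le_two
    ((add_nonneg integral_re integral_im).trans_eq (integral_add integrable_re integrable_im).symm)

end SecondVariation

section StabilityRadius

/-- The half-width of an interval of admissible parameters `c` around `2`; the constant `20` is not
optimal. -/
def stabilityRadius (𝓔 : ℝ) : ℝ := √(2 * (1 - 𝓔)) - 20 * (1 - 𝓔)

variable {𝓔 : ℝ}

theorem stabilityRadius_pos (h0 : 1 - 1 / 10000 < 𝓔) (h1 : 𝓔 < 1) : 0 < stabilityRadius 𝓔 :=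
  sub_pos.2 (Real.lt_sqrt_of_sq_lt (by nlinarith))

theorem stabilityRadius_lt_one (h0 : 1 - 1 / 10000 < 𝓔) (h1 : 𝓔 < 1) : stabilityRadius 𝓔 < 1 :=
  (sub_lt_self _ (by linarith)).trans ((Real.sqrt_lt' one_pos).2 (by linarith))

theorem stabilityRadius_sq_le (h0 : 1 - 1 / 10000 < 𝓔) (h1 : 𝓔 < 1) :
    stabilityRadius 𝓔 ^ 2 ≤ 2 * (1 - 𝓔) * (1 - 10 * √(1 - 𝓔)) := by
  have hr : 0 ≤ √(1 - 𝓔) := Real.sqrt_nonneg _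
  have hr' : √(1 - 𝓔) ≤ 1 / 100 := Real.sqrt_le_iff.2 ⟨by norm_num, by linarith⟩
  have hsq : 1 - 𝓔 = √(1 - 𝓔) ^ 2 := (Real.sq_sqrt (by linarith)).symm
  have hone : 1 ≤ √2 := Real.one_le_sqrt.2 one_le_two
  have htwo : √2 ^ 2 = 2 := Real.sq_sqrt zero_le_two
  rw [stabilityRadius, Real.sqrt_mul zero_le_two]
  set r := √(1 - 𝓔)
  rw [hsq]
  calc (√2 * r - 20 * r ^ 2) ^ 2 = r ^ 2 * (√2 ^ 2 + r * (400 * r - 40 * √2)) := by ring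
    _ ≤ r ^ 2 * (2 + r * (400 * (1 / 100) - 40 * 1)) := by rw [htwo]; gcongr
    _ ≤ r ^ 2 * (2 + r * -20) := by gcongr; norm_num
    _ = 2 * r ^ 2 * (1 - 10 * r) := by ring

theorem isBigO_stabilityRadius_sub (l : Filter ℝ) :
    (fun 𝓔 => stabilityRadius 𝓔 - √(2 * (1 - 𝓔))) =O[l] fun 𝓔 => 1 - 𝓔 := by
  simp only [stabilityRadius, sub_sub_cancel_left]
  exact ((Asymptotics.isBigO_refl _ l).const_mul_left 20).neg_left

end StabilityRadius

end CnoidalNLS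

end

theorem proposition1 :
    ∃ 𝓔₀ ∈ Set.Ioo (0 : ℝ) 1, ∃ cminus cplus : ℝ → ℝ,
      (∀ 𝓔 ∈ Set.Ioo 𝓔₀ 1,
        1 < cminus 𝓔 ∧ cminus 𝓔 < 2 ∧ 2 < cplus 𝓔 ∧ cplus 𝓔 < 3 ∧
        ∀ c ∈ Set.Ioo (cminus 𝓔) (cplus 𝓔), ∀ w w₁ w₂ : ℝ → ℂ, CnoidalNLS.IsH2 w w₁ w₂ →
          MeasureTheory.Integrable (CnoidalNLS.secondVariationDensity 𝓔 c w w₁ w₂) ∧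
          0 ≤ CnoidalNLS.secondVariation 𝓔 c w w₁ w₂) ∧
      Asymptotics.IsBigO (nhdsWithin 1 (Set.Iio 1))
        (fun 𝓔 : ℝ => cminus 𝓔 - (2 - Real.sqrt (2 * (1 - 𝓔)))) (fun 𝓔 : ℝ => 1 - 𝓔) ∧
      Asymptotics.IsBigO (nhdsWithin 1 (Set.Iio 1))
        (fun 𝓔 : ℝ => cplus 𝓔 - (2 + Real.sqrt (2 * (1 - 𝓔)))) (fun 𝓔 : ℝ => 1 - 𝓔) := by
  open CnoidalNLS in
  refine ⟨1 - 1 / 10000, by norm_num, fun 𝓔 => 2 - stabilityRadius 𝓔,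
    fun 𝓔 => 2 + stabilityRadius 𝓔, fun 𝓔 ⟨h0, h1⟩ => ?_, ?_, ?_⟩
  · have hpos := stabilityRadius_pos h0 h1
    have hlt := stabilityRadius_lt_one h0 h1
    refine ⟨by linarith, by linarith, by linarith, by linarith, fun c ⟨hc, hc'⟩ w w₁ w₂ hw => ?_⟩
    refine secondVariation_nonneg h0.le h1 (le_trans ?_ (stabilityRadius_sq_le h0 h1)) hw
    exact sq_le_sq' (by linarith) (by linarith)
  · refine (isBigO_stabilityRadius_sub _).neg_left.congr_left fun 𝓔 => ?_
    ring
  · refine (isBigO_stabilityRadius_sub _).congr_left fun 𝓔 => ?_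
    ring
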